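/- For $\delta>0$ let $\mathbb{C}_\delta$ be the square grid with vertex set $\{\delta(j+ik): j,k\in\mathbb{Z}\}$ and edges between vertices at distance $\delta$. Let $$C_0(0,x+iy):=\frac{1}{4\pi^2}\int_0^{2\pi}\!\int_0^{2\pi}\frac{e^{i(x\theta-y\phi)}}{2i\sin\theta+2\sin\phi}\,d\theta\,d\phi ,\qquad C_0(z_1,z_2):=C_0(0,z_2-z_1)$$ be Kenyon's dimer coupling function. For $a$ the midpoint of a horizontal edge of $\mathbb{C}_\delta$ and $z\neq a$ the midpoint of an arbitrary edge of $\mathbb{C}_\delta$, define the full-plane discrete fermionic spinor by $$f_{\mathbb{C}_\delta}(a,z):=\cos\!\left(\tfrac{\pi}{8}\right)e^{\frac{\pi i}{8}}\left(C_0\!\left(\tfrac{2(a+\frac{\delta}{2})}{\delta},\tfrac{2z}{\delta}\right)+C_0\!\left(\tfrac{2(a-\frac{i\delta}{2})}{\delta},\tfrac{2z}{\delta}\right)\right)+\sin\!\left(\tfrac{\pi}{8}\right)e^{-\frac{3\pi i}{8}}\left(C_0\!\left(\tfrac{2(a-\frac{\delta}{2})}{\delta},\tfrac{2z}{\delta}\right)+C_0\!\left(\tfrac{2(a+\frac{i\delta}{2})}{\delta},\tfrac{2z}{\delta}\right)\right),$$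 and set $f_{\mathbb{C}_\delta}(a,a):=\frac{2+\sqrt2}{4}$. For arbitrary $a,z\in\mathbb{C}$, let $f_{\mathbb{C}_\delta}(a,z)$ denote the value obtained by replacing $a$ by a closest midpoint of a horizontal edge of $\mathbb{C}_\delta$ and $z$ by a closest midpoint of an edge of $\mathbb{C}_\delta$ (ties being broken arbitrarily). Theorem. For every $\epsilon>0$, $$\frac1\delta f_{\mathbb{C}_\delta}(a,z)\longrightarrow f_{\mathbb{C}}(a,z):=\frac{1}{2\pi(z-a)}\qquad\text{as }\delta\to0^+,$$ uniformly on $\{(a,z)\in\mathbb{C}^2:|a-z|\ge\epsilon\}$. -/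

import Mathlib

open Filter Topology

noncomputable section

namespace FullPlaneSpinor

/-- The vertices `δ (j + i k)`, `j, k ∈ ℤ`, of the square grid of mesh size `δ`. -/
def gridVertices (δ : ℝ) : Set ℂ :=
  {v | ∃ j k : ℤ, v = (δ : ℂ) * ((j : ℂ) + (k : ℂ) * Complex.I)}

/-- The midpoints of the edges of the grid (two vertices span an edge when they are at
distance `δ`). -/
def edgeMidpoints (δ : ℝ) : Set ℂ :=
  {z | ∃ v ∈ gridVertices δ, ∃ w ∈ gridVertices δ, dist v w = δ ∧ z = midpoint ℝ v w}

/-- The midpoints of the horizontal edges (those parallel to the real axis). -/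
def horizontalEdgeMidpoints (δ : ℝ) : Set ℂ :=
  {z | ∃ v ∈ gridVertices δ, ∃ w ∈ gridVertices δ,
    dist v w = δ ∧ v.im = w.im ∧ z = midpoint ℝ v w}

/-- `p` is a point of `S` at minimal distance from `w` (there may be several such points). -/
def IsClosestPoint (S : Set ℂ) (w p : ℂ) : Prop :=
  p ∈ S ∧ ∀ q ∈ S, dist w p ≤ dist w q

/-- Kenyon's coupling function `C₀(0, x + i y)`. The integrand has singularities of type `1/r`
at the zeros of the denominator, which are integrable in the plane, so that the double
integral converges absolutely. -/
def couplingFromZero (x y : ℝ) : ℂ :=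
  1 / (4 * (Real.pi : ℂ) ^ 2) *
    ∫ φ in (0 : ℝ)..2 * Real.pi, ∫ θ in (0 : ℝ)..2 * Real.pi,
      Complex.exp (Complex.I * ((x * θ - y * φ : ℝ) : ℂ)) /
        (2 * Complex.I * (Real.sin θ : ℂ) + 2 * (Real.sin φ : ℂ))

/-- Kenyon's coupling function `C₀(z₁, z₂) = C₀(0, z₂ - z₁)`. It is only used at points with
integer coordinates. -/
def coupling (z₁ z₂ : ℂ) : ℂ :=
  couplingFromZero (z₂ - z₁).re (z₂ - z₁).im

/-- The full-plane discrete fermionic spinor. It is meant for `a` the midpoint of a horizontal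
edge and `z` the midpoint of an edge of the grid of mesh size `δ`. -/
def discreteSpinor (δ : ℝ) (a z : ℂ) : ℂ :=
  open Classical in
  if a = z then (2 + (Real.sqrt 2 : ℂ)) / 4
  else
    (Real.cos (Real.pi / 8) : ℂ) * Complex.exp (Real.pi * Complex.I / 8) *
        (coupling (2 * (a + δ / 2) / δ) (2 * z / δ) +
          coupling (2 * (a - Complex.I * δ / 2) / δ) (2 * z / δ)) +
      (Real.sin (Real.pi / 8) : ℂ) * Complex.exp (-(3 * Real.pi * Complex.I / 8)) *
        (coupling (2 * (a - δ / 2) / δ) (2 * z / δ) +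
          coupling (2 * (a + Complex.I * δ / 2) / δ) (2 * z / δ))

/-- The continuous full-plane spinor. -/
def continuousSpinor (a z : ℂ) : ℂ :=
  1 / (2 * (Real.pi : ℂ) * (z - a))

end FullPlaneSpinor

end

/-!
The inner integral of the coupling function is a contour integral over the unit circle. For
`x ≥ 0` Cauchy's formula evaluates it, and on the sublattice where `x + y` is odd (the only points
at which the spinor evaluates the coupling function) the two halves of the outer integral agree.
Hence `2π C₀(0, x + i y)` is the single integral `couplingIntegral x y` of
`exp (-x t - i y φ) / cosh t` over `0 ≤ φ ≤ π`, where `sinh t = sin φ`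
(`couplingFromZero_natCast`). Negative `x` are reached by the oddness of `C₀`.

For large `z = x + i y` this integral is governed by the endpoints `0` and `π`, where `t` vanishes
with slope `1` and `-1`; they contribute `1 / z` and `(-1) ^ y / conj z`. The remainder is
`O(1 / |z|²)` uniformly in the direction of `z` (`exists_norm_couplingIntegral_sub_le`), for two
reasons. If `|y| ≥ x`, the derivative `x t' + i y` of the exponent is at least `|y|` in absolute
value, and two integrations by parts suffice (`exists_norm_integral_sub_endpoints_le`). If
`x ≥ |y|`, that derivative may be small at `φ = π / 2`, but there `exp (-x t)` is exponentially
small; each half of the interval is then treated by comparing the integrand with the derivative of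
`exp (-x t - i y φ)` (`norm_half_integral_sub_le`).

The spinor is a combination of two sums `C₀ + C₀` at neighbours of the lattice point
`D = 2 (z - a) / δ`, and in each sum the two values of `y` have opposite parity. So the
antiholomorphic terms cancel and each sum is `1 / (π D) + O(1 / |D|²)`; the two coefficients add up
to `1` (`spinor_coefficients`). Dividing by `δ` gives `1 / (2π (z - a))` with error
`O(δ / |z - a|²)` (`exists_norm_discreteSpinor_sub_le`), and rounding `a` and `z` moves them by at
most `2 δ` each.
-/

namespace FullPlaneSpinor

open Complex (I)

/-! ### Integration by parts against a damped oscillation -/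

/-- The damped oscillation `exp (-(x t(φ) + i y φ))` with damping profile `t`. -/
noncomputable def wave (t : ℝ → ℝ) (x y φ : ℝ) : ℂ :=
  Complex.exp (-((x * t φ : ℝ) + (y * φ : ℝ) * I))

/-- The derivative of the exponent of `wave`, up to sign; `c` is the derivative of the damping
profile. -/
noncomputable def rate (c : ℝ → ℝ) (x y φ : ℝ) : ℂ :=
  (x * c φ : ℝ) + y * I

lemma abs_le_norm_rate (c : ℝ → ℝ) (x y φ : ℝ) : |y| ≤ ‖rate c x y φ‖ := by
  have h := Complex.abs_im_le_norm (rate c x y φ)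
  simpa [rate] using h

lemma norm_wave (t : ℝ → ℝ) (x y φ : ℝ) : ‖wave t x y φ‖ = Real.exp (-(x * t φ)) := by
  rw [wave, Complex.norm_exp]
  simp

lemma norm_wave_le_one {t : ℝ → ℝ} {x φ : ℝ} (y : ℝ) (hx : 0 ≤ x) (ht : 0 ≤ t φ) :
    ‖wave t x y φ‖ ≤ 1 := by
  rw [norm_wave, Real.exp_le_one_iff]
  nlinarith [mul_nonneg hx ht]

lemma hasDerivAt_wave {t : ℝ → ℝ} {c φ : ℝ} (x y : ℝ) (ht : HasDerivAt t c φ) :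
    HasDerivAt (wave t x y) (-((x * c : ℝ) + y * I) * wave t x y φ) φ := by
  have h1 : HasDerivAt (fun φ : ℝ => ((x * t φ : ℝ) : ℂ)) ((x * c : ℝ) : ℂ) φ :=
    (ht.const_mul x).ofReal_comp
  have h2 : HasDerivAt (fun φ : ℝ => ((y * φ : ℝ) : ℂ) * I) ((y : ℂ) * I) φ := by
    simpa using (((hasDerivAt_id φ).const_mul y).ofReal_comp).mul_const I
  have h3 := ((h1.add h2).neg).cexp
  refine h3.congr_deriv ?_
  simp only [wave, Pi.neg_apply, Pi.add_apply]
  ring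

lemma hasDerivAt_rate {c : ℝ → ℝ} {c₁ φ : ℝ} (x y : ℝ) (hc : HasDerivAt c c₁ φ) :
    HasDerivAt (rate c x y) ((x * c₁ : ℝ) : ℂ) φ :=
  ((hc.const_mul x).ofReal_comp).add_const _

lemma continuous_wave {t : ℝ → ℝ} (ht : Continuous t) (x y : ℝ) : Continuous (wave t x y) := by
  unfold wave; fun_prop

lemma continuous_rate {c : ℝ → ℝ} (hc : Continuous c) (x y : ℝ) : Continuous (rate c x y) := by
  unfold rate; fun_prop

/-- Integration by parts against `wave`, obtained by dividing by the logarithmic derivative. -/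
lemma integral_mul_wave {t c c₁ : ℝ → ℝ} {w w₁ : ℝ → ℂ} {x y : ℝ} (hy : y ≠ 0) (a b : ℝ)
    (ht : ∀ φ, HasDerivAt t (c φ) φ) (hc : ∀ φ, HasDerivAt c (c₁ φ) φ)
    (hw : ∀ φ, HasDerivAt w (w₁ φ) φ) (hc₁ : Continuous c₁) (hw₁ : Continuous w₁) :
    ∫ φ in a..b, w φ * wave t x y φ =
      w a / rate c x y a * wave t x y a - w b / rate c x y b * wave t x y b +
        ∫ φ in a..b, (w₁ φ / rate c x y φ - w φ * (x * c₁ φ : ℝ) / rate c x y φ ^ 2) *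
          wave t x y φ := by
  have hq : ∀ φ, rate c x y φ ≠ 0 := fun φ => norm_pos_iff.1
    ((abs_pos.2 hy).trans_le (abs_le_norm_rate c x y φ))
  have htc : Continuous t := continuous_iff_continuousAt.2 fun φ => (ht φ).continuousAt
  have hcc : Continuous c := continuous_iff_continuousAt.2 fun φ => (hc φ).continuousAt
  have hwc : Continuous w := continuous_iff_continuousAt.2 fun φ => (hw φ).continuousAt
  have hE := continuous_wave htc x y
  have hR := continuous_rate hcc x y
  have hF : Continuous fun φ => (w₁ φ / rate c x y φ -
      w φ * (x * c₁ φ : ℝ) / rate c x y φ ^ 2) * wave t x y φ := by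
    refine Continuous.mul (Continuous.sub (hw₁.div hR hq) (Continuous.div ?_ (hR.pow 2)
      fun φ => pow_ne_zero 2 (hq φ))) hE
    fun_prop
  have key : ∫ φ in a..b, ((w₁ φ / rate c x y φ -
      w φ * (x * c₁ φ : ℝ) / rate c x y φ ^ 2) * wave t x y φ - w φ * wave t x y φ) =
      w b / rate c x y b * wave t x y b - w a / rate c x y a * wave t x y a := by
    refine intervalIntegral.integral_eq_sub_of_hasDerivAt
      (f := fun φ => w φ / rate c x y φ * wave t x y φ) (fun φ _ => ?_)
      ((hF.sub (hwc.mul hE)).intervalIntegrable _ _)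
    have h := ((hw φ).div (hasDerivAt_rate x y (hc φ)) (hq φ)).mul (hasDerivAt_wave x y (ht φ))
    refine h.congr_deriv ?_
    have hq' := hq φ
    have e : ((x * c φ : ℝ) : ℂ) + y * I = rate c x y φ := rfl
    rw [e, Pi.div_apply]
    field_simp
    ring
  have hG : Continuous fun φ => w φ * wave t x y φ := hwc.mul hE
  rw [intervalIntegral.integral_sub (hF.intervalIntegrable _ _)
    (hG.intervalIntegrable _ _)] at key
  linear_combination -key

/-- When the oscillation dominates the damping, an integral against `wave` is given by its
endpoint contributions, with a relative error of the order of the inverse frequency. -/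
lemma exists_norm_integral_sub_endpoints_le {t h : ℝ → ℝ} {a b : ℝ} (hab : a ≤ b)
    (ht : ContDiff ℝ 3 t) (hh : ContDiff ℝ 2 h) (ht0 : ∀ φ ∈ Set.Icc a b, 0 ≤ t φ) :
    ∃ K : ℝ, 0 ≤ K ∧ ∀ x y : ℝ, 0 ≤ x → x ≤ |y| → y ≠ 0 →
      ‖(∫ φ in a..b, (h φ : ℂ) * wave t x y φ) -
        (h a / rate (deriv t) x y a * wave t x y a -
          h b / rate (deriv t) x y b * wave t x y b)‖ ≤ K / y ^ 2 := by
  have hc : ContDiff ℝ 2 (deriv t) := (contDiff_succ_iff_deriv (n := 2)).1 ht |>.2.2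
  have hc1 : ContDiff ℝ 1 (deriv (deriv t)) := (contDiff_succ_iff_deriv (n := 1)).1 hc |>.2.2
  have hh1 : ContDiff ℝ 1 (deriv h) := (contDiff_succ_iff_deriv (n := 1)).1 hh |>.2.2
  have hc2 : Continuous (deriv (deriv (deriv t))) := hc1.continuous_deriv le_rfl
  have hh2 : Continuous (deriv (deriv h)) := hh1.continuous_deriv le_rfl
  have dt : ∀ φ, HasDerivAt t (deriv t φ) φ :=
    fun φ => (ht.differentiable (by norm_num) φ).hasDerivAt
  have dc : ∀ φ, HasDerivAt (deriv t) (deriv (deriv t) φ) φ :=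
    fun φ => (hc.differentiable (by norm_num) φ).hasDerivAt
  have dc1 : ∀ φ, HasDerivAt (deriv (deriv t)) (deriv (deriv (deriv t)) φ) φ :=
    fun φ => (hc1.differentiable (by norm_num) φ).hasDerivAt
  have dh : ∀ φ, HasDerivAt h (deriv h φ) φ :=
    fun φ => (hh.differentiable (by norm_num) φ).hasDerivAt
  have dh1 : ∀ φ, HasDerivAt (deriv h) (deriv (deriv h) φ) φ :=
    fun φ => (hh1.differentiable (by norm_num) φ).hasDerivAt
  generalize deriv (deriv (deriv t)) = c₂ at *
  generalize deriv (deriv t) = c₁ at *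
  generalize deriv t = c at *
  generalize deriv (deriv h) = h₂ at *
  generalize deriv h = h₁ at *
  have hcc := hc.continuous
  have hc1c := hc1.continuous
  have hhc := hh.continuous
  have hh1c := hh1.continuous
  have bdd : ∀ f : ℝ → ℝ, Continuous f → ∃ B : ℝ, ∀ φ ∈ Set.Icc a b, |f φ| ≤ B := fun f hf =>
    isCompact_Icc.exists_bound_of_continuousOn hf.continuousOn
  obtain ⟨B0, hB0⟩ := bdd h hhc
  obtain ⟨B1, hB1⟩ := bdd h₁ hh1c
  obtain ⟨B2, hB2⟩ := bdd h₂ hh2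
  obtain ⟨D1, hD1⟩ := bdd c₁ hc1c
  obtain ⟨D2, hD2⟩ := bdd c₂ hc2
  have pos : ∀ {f : ℝ → ℝ} {B : ℝ}, (∀ φ ∈ Set.Icc a b, |f φ| ≤ B) → 0 ≤ B := fun hf =>
    (abs_nonneg _).trans (hf a ⟨le_rfl, hab⟩)
  have pB0 := pos hB0
  have pB1 := pos hB1
  have pB2 := pos hB2
  have pD1 := pos hD1
  have pD2 := pos hD2
  set M := B1 + B0 * D1 with hM
  set N := (B2 + B1 * D1) + (B1 * D1 + B0 * D2) + 2 * (B0 * D1 ^ 2) + M * D1 with hN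
  have pM : 0 ≤ M := by positivity
  have pN : 0 ≤ N := by positivity
  refine ⟨2 * M + N * (b - a), by nlinarith [mul_nonneg pN (sub_nonneg.2 hab)], ?_⟩
  intro x y hx hxy hy
  have hy' : 0 < |y| := abs_pos.2 hy
  have hq : ∀ φ, rate c x y φ ≠ 0 := fun φ => norm_pos_iff.1
    (hy'.trans_le (abs_le_norm_rate c x y φ))
  have hR := continuous_rate hcc x y
  -- the derivative of `h / rate`, and the derivative of that
  let w : ℝ → ℂ := fun φ => h₁ φ / rate c x y φ - h φ * (x * c₁ φ : ℝ) / rate c x y φ ^ 2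
  let w₁ : ℝ → ℂ := fun φ =>
    (h₂ φ / rate c x y φ - h₁ φ * (x * c₁ φ : ℝ) / rate c x y φ ^ 2) -
      ((h₁ φ * (x * c₁ φ : ℝ) + h φ * (x * c₂ φ : ℝ)) / rate c x y φ ^ 2 -
        2 * (h φ * (x * c₁ φ : ℝ) ^ 2) / rate c x y φ ^ 3)
  have hw : ∀ φ, HasDerivAt w (w₁ φ) φ := by
    intro φ
    have d0 := hasDerivAt_rate x y (dc φ)
    have e1 := ((dh1 φ).ofReal_comp).div d0 (hq φ)
    have e2 := (((dh φ).ofReal_comp).mul (((dc1 φ).const_mul x).ofReal_comp)).div (d0.pow 2)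
      (pow_ne_zero 2 (hq φ))
    refine (e1.sub e2).congr_deriv ?_
    have hq' := hq φ
    simp only [w₁, Pi.pow_apply, Pi.mul_apply]
    field_simp
    push_cast
    ring
  have hw₁ : Continuous w₁ := by
    have := hq
    simp only [w₁]
    fun_prop (disch := simp [hq])
  -- `x ≤ |y| ≤ |rate|`: every factor `x` is absorbed by one power of `rate` in a denominator
  have nx : ∀ φ, ∀ k : ℕ, |x| ^ k * ‖rate c x y φ‖⁻¹ ^ k ≤ 1 := by
    intro φ k
    rw [← mul_pow]
    refine pow_le_one₀ (by positivity) ?_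
    rw [← div_eq_mul_inv, div_le_one (norm_pos_iff.2 (hq φ)), abs_of_nonneg hx]
    exact hxy.trans (abs_le_norm_rate c x y φ)
  have ny : ∀ φ, ‖rate c x y φ‖⁻¹ ≤ |y|⁻¹ := fun φ =>
    inv_anti₀ hy' (abs_le_norm_rate c x y φ)
  have bw : ∀ φ ∈ Set.Icc a b, ‖w φ‖ ≤ M * |y|⁻¹ := by
    intro φ hφ
    refine (norm_sub_le _ _).trans ?_
    simp only [norm_div, norm_mul, norm_pow, Complex.norm_real, Real.norm_eq_abs]
    have i1 := nx φ 1
    have i2 := ny φ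
    have j0 := hB0 φ hφ
    have j1 := hB1 φ hφ
    have j2 := hD1 φ hφ
    have : |h₁ φ| / ‖rate c x y φ‖ + |h φ| * (|x| * |c₁ φ|) / ‖rate c x y φ‖ ^ 2 =
      (|h₁ φ| + |h φ| * |c₁ φ| * (|x| ^ 1 * ‖rate c x y φ‖⁻¹ ^ 1)) * ‖rate c x y φ‖⁻¹ := by
      ring
    rw [this]
    have : |h₁ φ| + |h φ| * |c₁ φ| * (|x| ^ 1 * ‖rate c x y φ‖⁻¹ ^ 1) ≤ B1 + B0 * D1 * 1 := by
      gcongr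
    rw [mul_one] at this
    gcongr
  have bw1 : ∀ φ ∈ Set.Icc a b,
      ‖w₁ φ / rate c x y φ - w φ * (x * c₁ φ : ℝ) / rate c x y φ ^ 2‖ ≤ N * |y|⁻¹ ^ 2 := by
    intro φ hφ
    have i0 := bw φ hφ
    have i1 := nx φ 1
    have i3 := nx φ 2
    have i2 := ny φ
    have j0 := hB0 φ hφ
    have j1 := hB1 φ hφ
    have j2 := hB2 φ hφ
    have j3 := hD1 φ hφ
    have j4 := hD2 φ hφ
    have k1 : ‖w₁ φ‖ ≤ ((B2 + B1 * D1) + (B1 * D1 + B0 * D2) + 2 * (B0 * D1 ^ 2)) * |y|⁻¹ := by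
      have : ‖w₁ φ‖ ≤ (|h₂ φ| / ‖rate c x y φ‖ + |h₁ φ| * (|x| * |c₁ φ|) / ‖rate c x y φ‖ ^ 2) +
        ((|h₁ φ| * (|x| * |c₁ φ|) + |h φ| * (|x| * |c₂ φ|)) / ‖rate c x y φ‖ ^ 2 +
          2 * (|h φ| * (|x| * |c₁ φ|) ^ 2) / ‖rate c x y φ‖ ^ 3) := by
        refine (norm_sub_le _ _).trans (add_le_add ((norm_sub_le _ _).trans_eq ?_)
          ((norm_sub_le _ _).trans (add_le_add ?_ (le_of_eq ?_))))
        · simp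
        · rw [norm_div, norm_pow]
          gcongr
          refine (norm_add_le _ _).trans_eq ?_
          simp
        · simp
      refine this.trans ?_
      have e : (|h₂ φ| / ‖rate c x y φ‖ + |h₁ φ| * (|x| * |c₁ φ|) / ‖rate c x y φ‖ ^ 2) +
        ((|h₁ φ| * (|x| * |c₁ φ|) + |h φ| * (|x| * |c₂ φ|)) / ‖rate c x y φ‖ ^ 2 +
          2 * (|h φ| * (|x| * |c₁ φ|) ^ 2) / ‖rate c x y φ‖ ^ 3) =
        ((|h₂ φ| + |h₁ φ| * |c₁ φ| * (|x| ^ 1 * ‖rate c x y φ‖⁻¹ ^ 1)) +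
          (|h₁ φ| * |c₁ φ| + |h φ| * |c₂ φ|) * (|x| ^ 1 * ‖rate c x y φ‖⁻¹ ^ 1) +
          2 * (|h φ| * |c₁ φ| ^ 2) * (|x| ^ 2 * ‖rate c x y φ‖⁻¹ ^ 2)) * ‖rate c x y φ‖⁻¹ := by
        ring
      rw [e]
      have : (|h₂ φ| + |h₁ φ| * |c₁ φ| * (|x| ^ 1 * ‖rate c x y φ‖⁻¹ ^ 1)) +
          (|h₁ φ| * |c₁ φ| + |h φ| * |c₂ φ|) * (|x| ^ 1 * ‖rate c x y φ‖⁻¹ ^ 1) +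
          2 * (|h φ| * |c₁ φ| ^ 2) * (|x| ^ 2 * ‖rate c x y φ‖⁻¹ ^ 2) ≤
          (B2 + B1 * D1 * 1) + (B1 * D1 + B0 * D2) * 1 + 2 * (B0 * D1 ^ 2) * 1 := by
        gcongr
      simp only [mul_one] at this
      gcongr
    refine (norm_sub_le _ _).trans ?_
    simp only [norm_div, norm_mul, norm_pow, Complex.norm_real, Real.norm_eq_abs]
    have e : ‖w₁ φ‖ / ‖rate c x y φ‖ + ‖w φ‖ * (|x| * |c₁ φ|) / ‖rate c x y φ‖ ^ 2 =
        (‖w₁ φ‖ + ‖w φ‖ * |c₁ φ| * (|x| ^ 1 * ‖rate c x y φ‖⁻¹ ^ 1)) * ‖rate c x y φ‖⁻¹ := by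
      ring
    rw [e]
    have : ‖w₁ φ‖ + ‖w φ‖ * |c₁ φ| * (|x| ^ 1 * ‖rate c x y φ‖⁻¹ ^ 1) ≤
        ((B2 + B1 * D1) + (B1 * D1 + B0 * D2) + 2 * (B0 * D1 ^ 2)) * |y|⁻¹ +
          M * |y|⁻¹ * D1 * 1 := by
      gcongr
    calc _ ≤ (((B2 + B1 * D1) + (B1 * D1 + B0 * D2) + 2 * (B0 * D1 ^ 2)) * |y|⁻¹ +
          M * |y|⁻¹ * D1 * 1) * |y|⁻¹ := by gcongr
      _ = N * |y|⁻¹ ^ 2 := by rw [hN]; ring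
  -- the first integration by parts produces the endpoint terms, the second one bounds the rest
  have p1 := integral_mul_wave (t := t) (x := x) (w := fun φ => (h φ : ℂ))
    (w₁ := fun φ => (h₁ φ : ℂ)) hy a b dt dc (fun φ => (dh φ).ofReal_comp) hc1c (by fun_prop)
  have p2 := integral_mul_wave (x := x) hy a b dt dc hw hc1c hw₁
  rw [p1, add_sub_cancel_left]
  change ‖∫ φ in a..b, w φ * wave t x y φ‖ ≤ _
  rw [p2]
  have be : ∀ φ ∈ Set.Icc a b, ‖w φ / rate c x y φ * wave t x y φ‖ ≤ M * |y|⁻¹ ^ 2 := by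
    intro φ hφ
    rw [norm_mul, norm_div, div_eq_mul_inv]
    calc _ ≤ M * |y|⁻¹ * |y|⁻¹ * 1 := by
          gcongr
          · exact bw φ hφ
          · exact abs_le_norm_rate c x y φ
          · exact norm_wave_le_one y hx (ht0 φ hφ)
      _ = _ := by ring
  have bi : ‖∫ φ in a..b, (w₁ φ / rate c x y φ - w φ * (x * c₁ φ : ℝ) / rate c x y φ ^ 2) *
      wave t x y φ‖ ≤ N * |y|⁻¹ ^ 2 * |b - a| := by
    refine intervalIntegral.norm_integral_le_of_norm_le_const fun φ hφ => ?_
    rw [Set.uIoc_of_le hab] at hφ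
    have hφ' : φ ∈ Set.Icc a b := Set.Ioc_subset_Icc_self hφ
    rw [norm_mul]
    calc _ ≤ N * |y|⁻¹ ^ 2 * 1 := by
          gcongr
          · exact bw1 φ hφ'
          · exact norm_wave_le_one y hx (ht0 φ hφ')
      _ = _ := mul_one _
  rw [abs_of_nonneg (sub_nonneg.2 hab)] at bi
  refine (norm_add_le _ _).trans ((add_le_add ((norm_sub_le _ _).trans (add_le_add
    (be a ⟨le_rfl, hab⟩) (be b ⟨hab, le_rfl⟩))) bi).trans_eq ?_)
  rw [← sq_abs y]
  field_simp
  ring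

/-! ### Asymptotics of the one-dimensional integral -/

/-- The number `t` with `sinh t = sin φ`; for `0 < φ < π` it is the exponential rate at which the
inner Fourier integral of the coupling function decays in `x`. -/
noncomputable def damping (φ : ℝ) : ℝ := Real.arsinh (Real.sin φ)

/-- The weight `1 / cosh t`, where `sinh t = sin φ`. -/
noncomputable def amplitude (φ : ℝ) : ℝ := (√(1 + Real.sin φ ^ 2))⁻¹

/-- The coupling function reduced to a single integral, up to the factor `1 / (2π)`. -/
noncomputable def couplingIntegral (x y : ℝ) : ℂ :=
  ∫ φ in (0 : ℝ)..Real.pi, (amplitude φ : ℂ) * wave damping x y φ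

lemma one_le_sqrt_one_add_sq (s : ℝ) : 1 ≤ √(1 + s ^ 2) :=
  Real.one_le_sqrt.2 (by nlinarith [sq_nonneg s])

lemma contDiff_damping {n : WithTop ℕ∞} : ContDiff ℝ n damping :=
  Real.contDiff_arsinh.comp Real.contDiff_sin

lemma contDiff_amplitude {n : WithTop ℕ∞} : ContDiff ℝ n amplitude := by
  have h : ∀ φ : ℝ, 1 + Real.sin φ ^ 2 ≠ 0 := fun φ => by positivity
  exact ((contDiff_const.add (Real.contDiff_sin.pow 2)).sqrt h).inv fun φ =>
    (zero_lt_one.trans_le (one_le_sqrt_one_add_sq _)).ne'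

lemma hasDerivAt_damping (φ : ℝ) : HasDerivAt damping (amplitude φ * Real.cos φ) φ :=
  (Real.hasDerivAt_arsinh _).comp φ (Real.hasDerivAt_sin φ)

lemma damping_nonneg {φ : ℝ} (h0 : 0 ≤ φ) (h1 : φ ≤ Real.pi) : 0 ≤ damping φ :=
  Real.arsinh_nonneg_iff.2 (Real.sin_nonneg_of_nonneg_of_le_pi h0 h1)

lemma amplitude_pos (φ : ℝ) : 0 < amplitude φ :=
  inv_pos.2 (zero_lt_one.trans_le (one_le_sqrt_one_add_sq _))

lemma amplitude_le_one (φ : ℝ) : amplitude φ ≤ 1 :=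
  inv_le_one_of_one_le₀ (one_le_sqrt_one_add_sq _)

lemma one_sub_le_amplitude {φ : ℝ} (h0 : 0 ≤ φ) (h1 : φ ≤ Real.pi) : 1 - φ ≤ amplitude φ := by
  have hs := Real.sin_nonneg_of_nonneg_of_le_pi h0 h1
  have h2 : √(1 + Real.sin φ ^ 2) ≤ 1 + Real.sin φ := by
    rw [Real.sqrt_le_left (by linarith)]
    nlinarith
  have h3 := Real.sin_le h0
  have h4 : (1 + φ)⁻¹ ≤ amplitude φ :=
    inv_anti₀ (zero_lt_one.trans_le (one_le_sqrt_one_add_sq _)) (by linarith)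
  have h5 : 1 - φ ≤ (1 + φ)⁻¹ := by
    rw [← one_div, le_div_iff₀ (by linarith)]
    nlinarith
  linarith

/-- A linear lower bound, from `arsinh s ≥ log (1 + s) ≥ s / (1 + s)`. -/
lemma half_le_arsinh {s : ℝ} (h0 : 0 ≤ s) (h1 : s ≤ 1) : s / 2 ≤ Real.arsinh s := by
  have h2 : Real.log (1 + s) ≤ Real.arsinh s := by
    refine Real.log_le_log (by linarith) ?_
    linarith [one_le_sqrt_one_add_sq s]
  have h3 := Real.one_sub_inv_le_log_of_pos (show 0 < 1 + s by linarith)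
  have h4 : s / 2 ≤ 1 - (1 + s)⁻¹ := by
    have : 1 - (1 + s)⁻¹ = s / (1 + s) := by field_simp; ring
    rw [this]
    gcongr
    linarith
  linarith

lemma div_pi_le_damping {φ : ℝ} (h0 : 0 ≤ φ) (h1 : φ ≤ Real.pi / 2) :
    φ / Real.pi ≤ damping φ := by
  have hs := Real.sin_nonneg_of_nonneg_of_le_pi h0 (by linarith [Real.pi_pos])
  have h2 := Real.mul_le_sin h0 h1
  have h3 := half_le_arsinh hs (Real.sin_le_one φ)
  have h4 : φ / Real.pi = 2 / Real.pi * φ / 2 := by ring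
  unfold damping
  linarith

lemma integral_mul_exp_neg_le {b T : ℝ} (hb : 0 < b) (hT : 0 ≤ T) :
    ∫ φ in (0 : ℝ)..T, φ * Real.exp (-(b * φ)) ≤ 1 / b ^ 2 := by
  have h : ∫ φ in (0 : ℝ)..T, φ * Real.exp (-(b * φ)) =
      -((1 + b * T) / b ^ 2 * Real.exp (-(b * T))) -
        -((1 + b * 0) / b ^ 2 * Real.exp (-(b * 0))) := by
    refine intervalIntegral.integral_eq_sub_of_hasDerivAt
      (f := fun φ => -((1 + b * φ) / b ^ 2 * Real.exp (-(b * φ)))) (fun φ _ => ?_)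
      (Continuous.intervalIntegrable (by fun_prop) _ _)
    have h1 : HasDerivAt (fun φ : ℝ => b * φ) b φ := by
      simpa using (hasDerivAt_id φ).const_mul b
    refine ((((h1.const_add 1).div_const (b ^ 2)).mul h1.neg.exp).neg).congr_deriv ?_
    simp only [Pi.neg_apply]
    field_simp
    ring
  rw [h]
  have : 0 ≤ (1 + b * T) / b ^ 2 * Real.exp (-(b * T)) := by positivity
  simp only [mul_zero, add_zero, neg_zero, Real.exp_zero, mul_one]
  linarith

/-- When the damping dominates the oscillation, half of the integral is concentrated at `0`. -/
lemma norm_half_integral_sub_le {x y : ℝ} (hx : 0 < x) (hxy : |y| ≤ x) :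
    ‖(∫ φ in (0 : ℝ)..Real.pi / 2, (amplitude φ : ℂ) * wave damping x y φ) - 1 / (x + y * I)‖ ≤
      (2 * Real.pi ^ 2 + 2) / x ^ 2 := by
  have hpi := Real.pi_pos
  set Z : ℂ := x + y * I with hZ
  have hZx : x ≤ ‖Z‖ := by
    have := Complex.abs_re_le_norm Z
    simp only [hZ, Complex.add_re, Complex.ofReal_re, Complex.mul_re, Complex.I_re, mul_zero,
      Complex.ofReal_im, Complex.I_im, mul_one, sub_self, add_zero] at this
    exact (le_abs_self x).trans this
  have hZ0 : Z ≠ 0 := norm_pos_iff.1 (hx.trans_le hZx)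
  have cA : Continuous amplitude := (contDiff_amplitude (n := 0)).continuous
  have cW := continuous_wave (contDiff_damping (n := 0)).continuous x y
  have cF : Continuous fun φ : ℝ => (amplitude φ : ℂ) * wave damping x y φ := by fun_prop
  -- the part of the integrand that is not an exact derivative, of order `x φ` near `0`
  let g : ℝ → ℂ := fun φ =>
    (y * I * (amplitude φ - 1 : ℝ) + (x * amplitude φ * (1 - Real.cos φ) : ℝ)) *
      wave damping x y φ
  have cg : Continuous g := by simp only [g]; fun_prop
  have h1 : ∫ φ in (0 : ℝ)..Real.pi / 2, (g φ - Z * ((amplitude φ : ℂ) * wave damping x y φ)) =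
      wave damping x y (Real.pi / 2) - wave damping x y 0 := by
    refine intervalIntegral.integral_eq_sub_of_hasDerivAt (fun φ _ => ?_)
      ((cg.sub (cF.const_mul Z)).intervalIntegrable _ _)
    refine (hasDerivAt_wave x y (hasDerivAt_damping φ)).congr_deriv ?_
    simp only [g, hZ]
    push_cast
    ring
  rw [intervalIntegral.integral_sub (cg.intervalIntegrable _ _)
    ((cF.const_mul Z).intervalIntegrable _ _), intervalIntegral.integral_const_mul] at h1
  have w0 : wave damping x y 0 = 1 := by simp [wave, damping]
  have w1 : ‖wave damping x y (Real.pi / 2)‖ ≤ 2 / x := by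
    rw [norm_wave, Real.exp_neg]
    have := div_pi_le_damping (φ := Real.pi / 2) (by linarith) le_rfl
    have e : Real.pi / 2 / Real.pi = 1 / 2 := by field_simp
    rw [e] at this
    have h2 := Real.add_one_le_exp (x * damping (Real.pi / 2))
    have h3 : x / 2 ≤ Real.exp (x * damping (Real.pi / 2)) := by nlinarith
    calc _ ≤ (x / 2)⁻¹ := inv_anti₀ (by positivity) h3
      _ = 2 / x := by rw [inv_div]
  have hg : ‖∫ φ in (0 : ℝ)..Real.pi / 2, g φ‖ ≤ 2 * Real.pi ^ 2 / x := by
    have hb : ‖∫ φ in (0 : ℝ)..Real.pi / 2, g φ‖ ≤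
        ∫ φ in (0 : ℝ)..Real.pi / 2, 2 * x * (φ * Real.exp (-(x / Real.pi * φ))) := by
      refine intervalIntegral.norm_integral_le_of_norm_le (by positivity)
        (Filter.Eventually.of_forall fun φ hφ => ?_)
        (Continuous.intervalIntegrable (by fun_prop) _ _)
      have p0 : 0 ≤ φ := hφ.1.le
      have p1 : φ ≤ Real.pi := by linarith [hφ.2]
      have a0 := amplitude_pos φ
      have a1 := amplitude_le_one φ
      have a2 := one_sub_le_amplitude p0 p1
      have d0 := div_pi_le_damping p0 hφ.2
      have c0 := Real.one_sub_sq_div_two_le_cos (x := φ)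
      have c1 := Real.cos_le_one φ
      have c2 : 1 - Real.cos φ ≤ φ := by nlinarith [hφ.2, Real.pi_le_four]
      simp only [g]
      rw [norm_mul, norm_wave]
      have e1 : ‖(y * I * (amplitude φ - 1 : ℝ) +
          (x * amplitude φ * (1 - Real.cos φ) : ℝ) : ℂ)‖ ≤ 2 * x * φ := by
        refine (norm_add_le _ _).trans ?_
        rw [norm_mul, norm_mul, Complex.norm_I, Complex.norm_real, Complex.norm_real,
          Complex.norm_real, Real.norm_eq_abs, Real.norm_eq_abs, Real.norm_eq_abs, mul_one,
          abs_of_nonpos (by linarith : amplitude φ - 1 ≤ 0),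
          abs_of_nonneg (by have := sub_nonneg.2 c1; positivity :
            0 ≤ x * amplitude φ * (1 - Real.cos φ))]
        have : |y| * -(amplitude φ - 1) ≤ x * φ :=
          mul_le_mul hxy (by linarith) (by linarith) hx.le
        have : x * amplitude φ * (1 - Real.cos φ) ≤ x * 1 * φ := by
          have := sub_nonneg.2 c1
          gcongr
        linarith
      have e2 : -(x * damping φ) ≤ -(x / Real.pi * φ) := by
        have : x / Real.pi * φ = x * (φ / Real.pi) := by ring
        rw [this]
        gcongr
      calc _ ≤ (2 * x * φ) * Real.exp (-(x / Real.pi * φ)) := by gcongr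
        _ = _ := by ring
    refine hb.trans ?_
    rw [intervalIntegral.integral_const_mul]
    have := integral_mul_exp_neg_le (b := x / Real.pi) (T := Real.pi / 2) (by positivity)
      (by positivity)
    calc _ ≤ 2 * x * (1 / (x / Real.pi) ^ 2) := by gcongr
      _ = _ := by field_simp
  set L := ∫ φ in (0 : ℝ)..Real.pi / 2, (amplitude φ : ℂ) * wave damping x y φ with hL
  have e : L - 1 / Z = ((∫ φ in (0 : ℝ)..Real.pi / 2, g φ) -
      wave damping x y (Real.pi / 2)) / Z := by
    rw [w0] at h1
    field_simp
    linear_combination -h1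
  rw [e, norm_div]
  calc _ ≤ (2 * Real.pi ^ 2 / x + 2 / x) / x := by
        gcongr
        exact (norm_sub_le _ _).trans (add_le_add hg w1)
    _ = _ := by field_simp

lemma exp_neg_int_mul_pi (y : ℤ) : Complex.exp (-((y : ℂ) * Real.pi * I)) = (-1) ^ y := by
  have : -((y : ℂ) * Real.pi * I) = ((-y : ℤ) : ℂ) * (Real.pi * I) := by push_cast; ring
  rw [this, Complex.exp_int_mul, Complex.exp_pi_mul_I, zpow_neg, ← inv_zpow]
  norm_num

/-- Reflecting at the middle of `[0, π]` exchanges `y` with `-y`. -/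
lemma couplingIntegral_eq_add (x : ℝ) (y : ℤ) :
    couplingIntegral x y =
      (∫ φ in (0 : ℝ)..Real.pi / 2, (amplitude φ : ℂ) * wave damping x y φ) +
        (-1) ^ y *
          ∫ φ in (0 : ℝ)..Real.pi / 2, (amplitude φ : ℂ) * wave damping x (-(y : ℝ)) φ := by
  have cA : Continuous amplitude := (contDiff_amplitude (n := 0)).continuous
  have cW := continuous_wave (contDiff_damping (n := 0)).continuous x y
  have cF : Continuous fun φ : ℝ => (amplitude φ : ℂ) * wave damping x y φ := by fun_prop
  rw [couplingIntegral, ← intervalIntegral.integral_add_adjacent_intervals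
    (cF.intervalIntegrable 0 (Real.pi / 2)) (cF.intervalIntegrable _ _)]
  congr 1
  have h := intervalIntegral.integral_comp_sub_left (a := 0) (b := Real.pi / 2)
    (fun φ : ℝ => (amplitude φ : ℂ) * wave damping x y φ) Real.pi
  rw [sub_zero, show Real.pi - Real.pi / 2 = Real.pi / 2 by ring] at h
  rw [← h, ← intervalIntegral.integral_const_mul]
  refine intervalIntegral.integral_congr fun φ _ => ?_
  simp only [amplitude, wave, damping, Real.sin_pi_sub]
  rw [← exp_neg_int_mul_pi, mul_left_comm, ← Complex.exp_add]
  congr 2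
  push_cast
  ring

lemma norm_sq_add_mul_I (x y : ℝ) : ‖(x : ℂ) + y * I‖ ^ 2 = x ^ 2 + y ^ 2 := by
  rw [← Complex.normSq_eq_norm_sq, Complex.normSq_add_mul_I]

/-- The endpoints `0` and `π` contribute `1 / z` and `± 1 / conj z`, `z = x + i y`; the remainder
is uniformly of order `1 / |z|²`. -/
lemma exists_norm_couplingIntegral_sub_le :
    ∃ K : ℝ, 0 ≤ K ∧ ∀ (x : ℝ) (y : ℤ), 0 ≤ x → (x : ℂ) + y * I ≠ 0 →
      ‖couplingIntegral x y - (1 / (x + y * I) + (-1) ^ y / (x - y * I))‖ ≤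
        K / ‖(x : ℂ) + y * I‖ ^ 2 := by
  obtain ⟨K, hK, h⟩ := exists_norm_integral_sub_endpoints_le Real.pi_pos.le
    (contDiff_damping (n := 3)) (contDiff_amplitude (n := 2))
    (fun φ hφ => damping_nonneg hφ.1 hφ.2)
  refine ⟨2 * K + 4 * (2 * Real.pi ^ 2 + 2), by positivity, fun x y hx hz => ?_⟩
  have hn : ‖(x : ℂ) + y * I‖ ^ 2 = x ^ 2 + (y : ℝ) ^ 2 := by
    exact_mod_cast norm_sq_add_mul_I x y
  have hp : 0 < x ^ 2 + (y : ℝ) ^ 2 := by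
    rw [← hn]
    exact pow_pos (norm_pos_iff.2 hz) 2
  rw [hn]
  rcases le_total x |(y : ℝ)| with hxy | hxy
  · have hy : (y : ℝ) ≠ 0 := by
      intro h0
      have : x = 0 := le_antisymm (by simpa [h0] using hxy) hx
      simp [this, h0] at hp
    have h1 := h x y hx hxy hy
    have d0 : deriv damping 0 = 1 := by
      rw [(hasDerivAt_damping 0).deriv]; simp [amplitude]
    have dpi : deriv damping Real.pi = -1 := by
      rw [(hasDerivAt_damping Real.pi).deriv]; simp [amplitude]
    have e : (amplitude 0 : ℂ) / rate (deriv damping) x y 0 * wave damping x y 0 -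
        amplitude Real.pi / rate (deriv damping) x y Real.pi * wave damping x y Real.pi =
        1 / (x + y * I) + (-1) ^ y / (x - y * I) := by
      rw [rate, rate, d0, dpi, ← exp_neg_int_mul_pi]
      simp only [amplitude, wave, damping]
      simp only [Real.sin_zero, Real.sin_pi, Real.arsinh_zero]
      have : ((x * -1 : ℝ) : ℂ) + ((y : ℝ) : ℂ) * I = -(x - y * I) := by push_cast; ring
      rw [this, div_neg]
      simp
      ring
    rw [e] at h1
    refine h1.trans ?_
    have hy2 : 0 < (y : ℝ) ^ 2 := by positivity
    have hxy2 : x ^ 2 ≤ (y : ℝ) ^ 2 := by rw [← sq_abs (y : ℝ)]; gcongr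
    rw [div_le_div_iff₀ hy2 hp]
    nlinarith [Real.pi_pos, mul_nonneg hK hy2.le, mul_nonneg hK (sub_nonneg.2 hxy2),
      mul_nonneg (sq_nonneg Real.pi) hy2.le]
  · have hx0 : 0 < x := by
      refine lt_of_le_of_ne hx fun h0 => ?_
      have : (y : ℝ) = 0 := by
        rw [← h0] at hxy
        exact abs_nonpos_iff.1 hxy
      simp [← h0, this] at hp
    have h1 := norm_half_integral_sub_le hx0 hxy
    have h2 := norm_half_integral_sub_le (y := -(y : ℝ)) hx0 (by rwa [abs_neg])
    rw [couplingIntegral_eq_add]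
    set L1 := ∫ φ in (0 : ℝ)..Real.pi / 2, (amplitude φ : ℂ) * wave damping x y φ
    set L2 := ∫ φ in (0 : ℝ)..Real.pi / 2, (amplitude φ : ℂ) * wave damping x (-(y : ℝ)) φ
    have e : L1 + (-1) ^ y * L2 - (1 / (x + y * I) + (-1) ^ y / (x - y * I)) =
        (L1 - 1 / (x + (y : ℝ) * I)) +
          (-1) ^ y * (L2 - 1 / (x + ((-(y : ℝ) : ℝ) : ℂ) * I)) := by
      push_cast
      rw [show (x : ℂ) + -(y : ℂ) * I = x - y * I by ring]
      ring
    rw [e]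
    have h3 : ‖((-1 : ℂ)) ^ y‖ = 1 := by simp
    refine (norm_add_le _ _).trans ?_
    rw [norm_mul, h3, one_mul]
    refine (add_le_add h1 h2).trans ?_
    have hxy2 : (y : ℝ) ^ 2 ≤ x ^ 2 := by rw [← sq_abs (y : ℝ)]; gcongr
    have hx2 : 0 < x ^ 2 := by positivity
    rw [← add_div, div_le_div_iff₀ hx2 hp]
    have hp2 : 0 ≤ 2 * Real.pi ^ 2 + 2 := by positivity
    nlinarith [mul_nonneg hK hx2.le, mul_nonneg hp2 (sub_nonneg.2 hxy2)]

/-! ### Reduction of the coupling function to a single integral -/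

/-- The integrand of the coupling function. -/
noncomputable def couplingIntegrand (x y φ θ : ℝ) : ℂ :=
  Complex.exp (I * ((x * θ - y * φ : ℝ) : ℂ)) /
    (2 * I * (Real.sin θ : ℂ) + 2 * (Real.sin φ : ℂ))

lemma couplingFromZero_eq (x y : ℝ) :
    couplingFromZero x y = 1 / (4 * (Real.pi : ℂ) ^ 2) *
      ∫ φ in (0 : ℝ)..2 * Real.pi, ∫ θ in (0 : ℝ)..2 * Real.pi, couplingIntegrand x y φ θ :=
  rfl

lemma exp_I_mul_add_int_mul_two_pi (u : ℝ) (m : ℤ) :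
    Complex.exp (I * ((u + m * (2 * Real.pi) : ℝ) : ℂ)) = Complex.exp (I * (u : ℂ)) := by
  have : I * ((u + m * (2 * Real.pi) : ℝ) : ℂ) = I * u + m * (2 * Real.pi * I) := by
    push_cast; ring
  rw [this, Complex.exp_add, Complex.exp_int_mul_two_pi_mul_I, mul_one]

lemma couplingIntegrand_periodic_right (x : ℤ) (y φ : ℝ) :
    Function.Periodic (couplingIntegrand x y φ) (2 * Real.pi) := by
  intro θ
  rw [couplingIntegrand, couplingIntegrand, Real.sin_add_two_pi,
    ← exp_I_mul_add_int_mul_two_pi (x * θ - y * φ) x]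
  congr 4
  ring

/-- Shifting both angles by `π` changes the sign of the denominator and, on the sublattice where
`x + y` is odd, that of the numerator. -/
lemma couplingIntegrand_add_pi {x y : ℤ} (h : Odd (x + y)) (φ θ : ℝ) :
    couplingIntegrand x y (φ + Real.pi) (θ + Real.pi) = couplingIntegrand x y φ θ := by
  have h' : Odd (x - y) := by
    rw [Int.odd_sub]; exact Int.odd_add.1 h
  have e : I * ((x * (θ + Real.pi) - y * (φ + Real.pi) : ℝ) : ℂ) =
      I * ((x * θ - y * φ : ℝ) : ℂ) + ((x - y : ℤ) : ℂ) * (Real.pi * I) := by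
    push_cast; ring
  rw [couplingIntegrand, couplingIntegrand, Real.sin_add_pi, Real.sin_add_pi, e,
    Complex.exp_add, Complex.exp_int_mul, Complex.exp_pi_mul_I, h'.neg_one_zpow, mul_neg_one]
  push_cast
  rw [mul_neg, mul_neg, ← neg_add, neg_div_neg_eq]

lemma integral_couplingIntegrand_periodic {x y : ℤ} (h : Odd (x + y)) :
    Function.Periodic
      (fun φ => ∫ θ in (0 : ℝ)..2 * Real.pi, couplingIntegrand x y φ θ) Real.pi := by
  intro φ
  have h1 := (couplingIntegrand_periodic_right x y (φ + Real.pi)).intervalIntegral_add_eq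
    0 Real.pi
  rw [zero_add] at h1
  have h2 := intervalIntegral.integral_comp_add_right (a := 0) (b := 2 * Real.pi)
    (couplingIntegrand x y (φ + Real.pi)) Real.pi
  rw [zero_add, add_comm (2 * Real.pi)] at h2
  simp only [couplingIntegrand_add_pi h] at h2
  exact h1.trans h2.symm

lemma integral_comp_neg_of_periodic {f : ℝ → ℂ} {T : ℝ} (hf : Function.Periodic f T) :
    ∫ θ in (0 : ℝ)..T, f (-θ) = ∫ θ in (0 : ℝ)..T, f θ := by
  have h1 := hf.intervalIntegral_add_eq (-T) 0
  rw [neg_add_cancel, zero_add] at h1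
  rw [intervalIntegral.integral_comp_neg, neg_zero, h1]

lemma couplingIntegrand_neg (x y φ θ : ℝ) :
    couplingIntegrand (-x) (-y) (-φ) (-θ) = -couplingIntegrand x y φ θ := by
  have e : -x * -θ - -y * -φ = x * θ - y * φ := by ring
  rw [couplingIntegrand, couplingIntegrand, Real.sin_neg, Real.sin_neg, e]
  push_cast
  rw [mul_neg, mul_neg, ← neg_add, div_neg]

lemma couplingFromZero_neg {x y : ℤ} (h : Odd (x + y)) :
    couplingFromZero (-x) (-y) = -couplingFromZero x y := by
  rw [couplingFromZero_eq, couplingFromZero_eq, ← mul_neg, ← intervalIntegral.integral_neg]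
  congr 1
  have h' : Odd (-x + -y) := by rw [← neg_add]; exact h.neg
  have hper := integral_couplingIntegrand_periodic h'
  have hper2 := hper.nsmul 2
  rw [nsmul_eq_mul, Nat.cast_ofNat] at hper2
  push_cast at hper2
  rw [← integral_comp_neg_of_periodic hper2]
  refine intervalIntegral.integral_congr fun φ _ => ?_
  have hx := couplingIntegrand_periodic_right (-x) (-(y : ℝ)) (-φ)
  push_cast at hx
  rw [← integral_comp_neg_of_periodic hx, ← intervalIntegral.integral_neg]
  refine intervalIntegral.integral_congr fun θ _ => ?_
  exact couplingIntegrand_neg _ _ _ _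

/-- The inner integral is a contour integral over the unit circle. In `w = exp (i θ)` its integrand
has the poles `exp (-t)` and `-exp t`, where `sinh t = s > 0`, and only the first lies inside. -/
lemma integral_exp_div_eq (n : ℕ) {s : ℝ} (hs : 0 < s) :
    ∫ θ in (0 : ℝ)..2 * Real.pi,
      Complex.exp (I * ((n * θ : ℝ) : ℂ)) / (2 * I * (Real.sin θ : ℂ) + 2 * (s : ℂ)) =
      Real.pi * ((Real.exp (-(n * Real.arsinh s)) * (√(1 + s ^ 2))⁻¹ : ℝ) : ℂ) := by
  set r := √(1 + s ^ 2) with hr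
  have hr2 : r ^ 2 = 1 + s ^ 2 := Real.sq_sqrt (by positivity)
  have hr1 : 1 ≤ r := one_le_sqrt_one_add_sq s
  have hexp : Real.exp (-Real.arsinh s) = r - s := by
    rw [← Real.arsinh_neg, Real.exp_arsinh, neg_sq]; ring
  have ha0 : 0 < r - s := by rw [← hexp]; exact Real.exp_pos _
  have ha1 : r - s < 1 := by nlinarith
  have hball : ((r - s : ℝ) : ℂ) ∈ Metric.ball (0 : ℂ) 1 := by
    rw [mem_ball_zero_iff, Complex.norm_real, Real.norm_eq_abs, abs_of_pos ha0]
    exact ha1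
  have hden : ∀ w ∈ Metric.closedBall (0 : ℂ) 1, w + ((r + s : ℝ) : ℂ) ≠ 0 := by
    intro w hw h0
    rw [mem_closedBall_zero_iff, eq_neg_of_add_eq_zero_left h0, norm_neg, Complex.norm_real,
      Real.norm_eq_abs, abs_of_pos (by linarith)] at hw
    linarith
  have hd : DifferentiableOn ℂ (fun w : ℂ => w ^ n / (w + ((r + s : ℝ) : ℂ)))
      (Metric.closedBall 0 1) := by
    intro w hw
    have h1 : DifferentiableAt ℂ (fun w : ℂ => w + ((r + s : ℝ) : ℂ)) w := by fun_prop
    exact ((differentiableAt_fun_id.pow n).div h1 (hden w hw)).differentiableWithinAt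
  have hC := hd.circleIntegral_sub_inv_smul hball
  have hI : (I : ℂ) ≠ 0 := Complex.I_ne_zero
  have hrC : (r : ℂ) ≠ 0 := Complex.ofReal_ne_zero.2 (by linarith)
  have hr2C : (r : ℂ) ^ 2 = 1 + (s : ℂ) ^ 2 := by exact_mod_cast hr2
  have key : ∮ w in C(0, 1), (w - ((r - s : ℝ) : ℂ))⁻¹ • (w ^ n / (w + ((r + s : ℝ) : ℂ))) =
      I * ∫ θ in (0 : ℝ)..2 * Real.pi,
        Complex.exp (I * ((n * θ : ℝ) : ℂ)) / (2 * I * (Real.sin θ : ℂ) + 2 * (s : ℂ)) := by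
    rw [circleIntegral, ← intervalIntegral.integral_const_mul]
    refine intervalIntegral.integral_congr fun θ _ => ?_
    simp only [deriv_circleMap, smul_eq_mul]
    set w := circleMap 0 1 θ with hw
    have hwe : w = Complex.exp (θ * I) := by simp [hw, circleMap]
    have hw0 : w ≠ 0 := by rw [hwe]; exact Complex.exp_ne_zero _
    have hwn : Complex.exp (I * ((n * θ : ℝ) : ℂ)) = w ^ n := by
      rw [hwe, ← Complex.exp_nat_mul]
      push_cast
      ring_nf
    have hsin : 2 * I * (Real.sin θ : ℂ) = w - w⁻¹ := by
      rw [Complex.ofReal_sin, hwe, ← Complex.exp_neg, Complex.sin]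
      rw [show -(θ : ℂ) * I = -(θ * I) by ring]
      linear_combination (Complex.exp (-(θ * I)) - Complex.exp (θ * I)) * Complex.I_sq
    have hfac : 2 * I * (Real.sin θ : ℂ) + 2 * (s : ℂ) =
        (w - ((r - s : ℝ) : ℂ)) * (w + ((r + s : ℝ) : ℂ)) * w⁻¹ := by
      rw [hsin]
      field_simp
      push_cast
      linear_combination hr2C
    rw [hwn, hfac, div_eq_mul_inv, div_eq_mul_inv, mul_inv, mul_inv, inv_inv]
    ring
  rw [key, smul_eq_mul] at hC
  have hv : ((r - s : ℝ) : ℂ) ^ n / (((r - s : ℝ) : ℂ) + ((r + s : ℝ) : ℂ)) =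
      ((Real.exp (-(n * Real.arsinh s)) * r⁻¹ : ℝ) : ℂ) / 2 := by
    rw [show -(n * Real.arsinh s) = n * (-Real.arsinh s) by ring, Real.exp_nat_mul, hexp]
    push_cast
    rw [show (r : ℂ) - s + (r + s) = r * 2 by ring]
    field_simp
  rw [hv] at hC
  refine mul_left_cancel₀ hI (hC.trans ?_)
  ring

lemma integral_couplingIntegrand_eq (n : ℕ) (y : ℝ) {φ : ℝ} (h0 : 0 < φ) (h1 : φ < Real.pi) :
    ∫ θ in (0 : ℝ)..2 * Real.pi, couplingIntegrand n y φ θ =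
      Real.pi * ((amplitude φ : ℂ) * wave damping n y φ) := by
  have hs := Real.sin_pos_of_pos_of_lt_pi h0 h1
  have e : ∀ θ : ℝ, couplingIntegrand n y φ θ = Complex.exp (-((y * φ : ℝ) * I)) *
      (Complex.exp (I * ((n * θ : ℝ) : ℂ)) /
        (2 * I * (Real.sin θ : ℂ) + 2 * (Real.sin φ : ℂ))) := by
    intro θ
    rw [couplingIntegrand, ← mul_div_assoc, ← Complex.exp_add]
    congr 2
    push_cast
    ring
  simp only [e]
  rw [intervalIntegral.integral_const_mul, integral_exp_div_eq n hs, wave, neg_add,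
    Complex.exp_add, amplitude, damping]
  push_cast
  ring

lemma couplingFromZero_natCast (n : ℕ) {y : ℤ} (h : Odd ((n : ℤ) + y)) :
    couplingFromZero n y = 1 / (2 * Real.pi) * couplingIntegral n y := by
  have hpi := Real.pi_pos
  set G : ℝ → ℂ := fun φ => ∫ θ in (0 : ℝ)..2 * Real.pi, couplingIntegrand n y φ θ with hG
  have hper : Function.Periodic G Real.pi := by
    have := integral_couplingIntegrand_periodic h
    rwa [Int.cast_natCast] at this
  have cA : Continuous amplitude := (contDiff_amplitude (n := 0)).continuous
  have cW := continuous_wave (contDiff_damping (n := 0)).continuous n y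
  have cF : Continuous fun φ : ℝ => (Real.pi : ℂ) * ((amplitude φ : ℂ) * wave damping n y φ) := by
    fun_prop
  -- at the endpoints the inner integral diverges, so the formula holds on the open interval only
  have hGe : ∀ φ ∈ Set.Ioo 0 Real.pi,
      (Real.pi : ℂ) * ((amplitude φ : ℂ) * wave damping n y φ) = G φ := fun φ hφ =>
    (integral_couplingIntegrand_eq n y hφ.1 hφ.2).symm
  have hint : IntervalIntegrable G MeasureTheory.volume 0 Real.pi := by
    have := cF.intervalIntegrable (μ := MeasureTheory.volume) 0 Real.pi
    rw [intervalIntegrable_iff_integrableOn_Ioo_of_le hpi.le] at this ⊢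
    exact this.congr_fun hGe measurableSet_Ioo
  have hI1 : ∫ φ in (0 : ℝ)..Real.pi, G φ = Real.pi * couplingIntegral n y := by
    rw [couplingIntegral, ← intervalIntegral.integral_const_mul,
      intervalIntegral.integral_of_le hpi.le, intervalIntegral.integral_of_le hpi.le,
      MeasureTheory.integral_Ioc_eq_integral_Ioo, MeasureTheory.integral_Ioc_eq_integral_Ioo]
    exact (MeasureTheory.setIntegral_congr_fun measurableSet_Ioo hGe).symm
  have hI2 : ∫ φ in Real.pi..2 * Real.pi, G φ = ∫ φ in (0 : ℝ)..Real.pi, G φ := by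
    have := hper.intervalIntegral_add_eq Real.pi 0
    rwa [zero_add, ← two_mul] at this
  have hint2 : IntervalIntegrable G MeasureTheory.volume Real.pi (2 * Real.pi) :=
    hper.intervalIntegrable hpi.ne' (t := 0) (by rwa [zero_add]) _ _
  rw [couplingFromZero_eq]
  change _ * ∫ φ in (0 : ℝ)..2 * Real.pi, G φ = _
  rw [← intervalIntegral.integral_add_adjacent_intervals hint hint2, hI2, hI1]
  have : (Real.pi : ℂ) ≠ 0 := Complex.ofReal_ne_zero.2 hpi.ne'
  field_simp
  ring

lemma norm_one_div_two_pi_le_one : ‖(1 / (2 * Real.pi) : ℂ)‖ ≤ 1 := by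
  have : (1 / (2 * Real.pi) : ℂ) = ((1 / (2 * Real.pi) : ℝ) : ℂ) := by push_cast; rfl
  have hpos := Real.pi_pos
  rw [this, Complex.norm_real, Real.norm_eq_abs, abs_of_pos (by positivity),
    div_le_one (by positivity)]
  linarith [Real.pi_gt_three]

/-- Asymptotics of the coupling function, with an error that is uniform over the directions. -/
lemma exists_norm_couplingFromZero_sub_le :
    ∃ K : ℝ, 0 ≤ K ∧ ∀ x y : ℤ, Odd (x + y) →
      ‖couplingFromZero x y -
          1 / (2 * Real.pi) * (1 / (x + y * I) + (-1) ^ y / (x - y * I))‖ ≤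
        K / ‖(x : ℂ) + y * I‖ ^ 2 := by
  obtain ⟨K, hK, h⟩ := exists_norm_couplingIntegral_sub_le
  -- nonnegative `x`; the other case follows by oddness
  have hnat : ∀ (n : ℕ) (y : ℤ), Odd ((n : ℤ) + y) →
      ‖couplingFromZero n y -
          1 / (2 * Real.pi) * (1 / (n + y * I) + (-1) ^ y / (n - y * I))‖ ≤
        K / ‖(n : ℂ) + y * I‖ ^ 2 := by
    intro n y hny
    have hz : (n : ℂ) + y * I ≠ 0 := by
      intro h0
      have h1 := congrArg Complex.re h0
      have h2 := congrArg Complex.im h0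
      simp at h1 h2
      subst h1 h2
      simp at hny
    have h1 := h n y (Nat.cast_nonneg n) (by exact_mod_cast hz)
    rw [couplingFromZero_natCast n hny, ← mul_sub, norm_mul]
    have h2 := norm_one_div_two_pi_le_one
    push_cast at h1
    exact (mul_le_of_le_one_left (norm_nonneg _) h2).trans h1
  refine ⟨K, hK, fun x y hxy => ?_⟩
  obtain ⟨n, rfl | rfl⟩ := Int.eq_nat_or_neg x
  · simpa using hnat n y hxy
  · have hxy' : Odd ((n : ℤ) + -y) := by
      have := hxy.neg
      rwa [neg_add, neg_neg] at this
    have h1 := hnat n (-y) hxy'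
    have h2 := couplingFromZero_neg hxy'
    push_cast at h1 h2 ⊢
    rw [neg_neg] at h2
    rw [h2]
    have h3 : (-1 : ℂ) ^ (-y) = (-1) ^ y := by
      rw [zpow_neg, ← inv_zpow]; norm_num
    rw [h3] at h1
    rw [show -(n : ℂ) + y * I = -(n + -y * I) by ring,
      show -(n : ℂ) - y * I = -(n - -y * I) by ring, norm_neg, div_neg, div_neg, ← neg_add,
      mul_neg, ← neg_sub', norm_neg]
    exact h1

/-! ### Midpoints of edges -/

lemma sq_add_sq_eq_one_of_dist {δ : ℝ} (hδ : 0 < δ) {j k j' k' : ℤ}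
    (h : dist ((δ : ℂ) * (j + k * I)) ((δ : ℂ) * (j' + k' * I)) = δ) :
    (j - j') ^ 2 + (k - k') ^ 2 = 1 := by
  have e : (δ : ℂ) * (j + k * I) - (δ : ℂ) * (j' + k' * I) =
      δ * (((j - j' : ℤ) : ℝ) + ((k - k' : ℤ) : ℝ) * I) := by
    push_cast; ring
  rw [dist_eq_norm, e, norm_mul, Complex.norm_real, Real.norm_eq_abs, abs_of_pos hδ] at h
  have h1 := mul_left_cancel₀ hδ.ne' (h.trans (mul_one δ).symm)
  have h2 := norm_sq_add_mul_I ((j - j' : ℤ) : ℝ) ((k - k' : ℤ) : ℝ)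
  rw [h1, one_pow] at h2
  exact_mod_cast h2.symm

lemma midpoint_grid (δ : ℝ) (j k j' k' : ℤ) :
    midpoint ℝ ((δ : ℂ) * (j + k * I)) ((δ : ℂ) * (j' + k' * I)) =
      δ / 2 * ((j + j' : ℤ) + (k + k' : ℤ) * I) := by
  rw [midpoint_eq_smul_add, Complex.real_smul]
  push_cast
  rw [invOf_eq_inv]
  push_cast
  ring

lemma exists_of_mem_edgeMidpoints {δ : ℝ} (hδ : 0 < δ) {z : ℂ} (hz : z ∈ edgeMidpoints δ) :
    ∃ m n : ℤ, Odd (m + n) ∧ z = δ / 2 * (m + n * I) := by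
  obtain ⟨v, ⟨j, k, rfl⟩, w, ⟨j', k', rfl⟩, hd, rfl⟩ := hz
  refine ⟨j + j', k + k', ?_, midpoint_grid ..⟩
  have h := sq_add_sq_eq_one_of_dist hδ hd
  have h1 : Odd ((j - j') ^ 2 + (k - k') ^ 2) := by rw [h]; exact odd_one
  grind [Int.odd_add, Int.even_add, Int.odd_sub, Int.even_sub, Int.odd_pow, Int.even_pow]

lemma exists_of_mem_horizontalEdgeMidpoints {δ : ℝ} (hδ : 0 < δ) {z : ℂ}
    (hz : z ∈ horizontalEdgeMidpoints δ) :
    ∃ m n : ℤ, Odd m ∧ Even n ∧ z = δ / 2 * (m + n * I) := by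
  obtain ⟨v, ⟨j, k, rfl⟩, w, ⟨j', k', rfl⟩, hd, him, rfl⟩ := hz
  have hk : k = k' := by
    simp [hδ.ne'] at him
    exact him
  subst hk
  refine ⟨j + j', k + k, ?_, ⟨k, rfl⟩, midpoint_grid ..⟩
  have h := sq_add_sq_eq_one_of_dist hδ hd
  have h1 : Odd ((j - j') ^ 2 + (k - k) ^ 2) := by rw [h]; exact odd_one
  grind [Int.odd_add, Int.even_add, Int.odd_sub, Int.even_sub, Int.odd_pow, Int.even_pow]

lemma horizontalEdgeMidpoints_subset (δ : ℝ) :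
    horizontalEdgeMidpoints δ ⊆ edgeMidpoints δ := by
  rintro z ⟨v, hv, w, hw, hd, -, h⟩
  exact ⟨v, hv, w, hw, hd, h⟩

/-- The bound `2 δ` is not optimal; only its order in `δ` matters. -/
lemma exists_mem_horizontalEdgeMidpoints_dist_le {δ : ℝ} (hδ : 0 < δ) (w : ℂ) :
    ∃ q ∈ horizontalEdgeMidpoints δ, dist w q ≤ 2 * δ := by
  set j := ⌊w.re / δ⌋ with hj
  set k := ⌊w.im / δ⌋ with hk
  refine ⟨_, ⟨_, ⟨j, k, rfl⟩, _, ⟨j + 1, k, rfl⟩, ?_, ?_, rfl⟩, ?_⟩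
  · have e : (δ : ℂ) * (j + k * I) - (δ : ℂ) * ((j + 1 : ℤ) + k * I) = -(δ : ℂ) := by
      push_cast; ring
    rw [dist_eq_norm, e, norm_neg, Complex.norm_real, Real.norm_eq_abs, abs_of_pos hδ]
  · simp
  · rw [midpoint_grid, dist_eq_norm]
    refine (Complex.norm_le_abs_re_add_abs_im _).trans ?_
    have h1 := Int.floor_le (w.re / δ)
    have h2 := Int.lt_floor_add_one (w.re / δ)
    have h3 := Int.floor_le (w.im / δ)
    have h4 := Int.lt_floor_add_one (w.im / δ)
    rw [← hj] at h1 h2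
    rw [← hk] at h3 h4
    rw [le_div_iff₀ hδ] at h1 h3
    rw [div_lt_iff₀ hδ] at h2 h4
    have er : (w - δ / 2 * ((j + (j + 1) : ℤ) + (k + k : ℤ) * I)).re =
        w.re - δ * (j + 1 / 2) := by
      rw [show (δ : ℂ) / 2 * ((j + (j + 1) : ℤ) + (k + k : ℤ) * I) =
        ((δ * (j + 1 / 2) : ℝ) : ℂ) + ((δ * k : ℝ) : ℂ) * I by push_cast; ring]
      simp
    have ei : (w - δ / 2 * ((j + (j + 1) : ℤ) + (k + k : ℤ) * I)).im = w.im - δ * k := by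
      rw [show (δ : ℂ) / 2 * ((j + (j + 1) : ℤ) + (k + k : ℤ) * I) =
        ((δ * (j + 1 / 2) : ℝ) : ℂ) + ((δ * k : ℝ) : ℂ) * I by push_cast; ring]
      simp
    rw [er, ei]
    have a1 : |w.re - δ * (j + 1 / 2)| ≤ δ := by rw [abs_le]; constructor <;> linarith
    have a2 : |w.im - δ * k| ≤ δ := by rw [abs_le]; constructor <;> linarith
    linarith

lemma IsClosestPoint.dist_le {S : Set ℂ} {δ : ℝ} (hδ : 0 < δ)
    (hS : horizontalEdgeMidpoints δ ⊆ S) {w p : ℂ} (h : IsClosestPoint S w p) :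
    dist w p ≤ 2 * δ := by
  obtain ⟨q, hq, hd⟩ := exists_mem_horizontalEdgeMidpoints_dist_le hδ w
  exact (h.2 q (hS hq)).trans hd

/-! ### Asymptotics of the discrete spinor -/

lemma norm_one_div_sub_one_div_le {D e : ℂ} (hD : 2 ≤ ‖D‖) (he : ‖e‖ ≤ 1) :
    ‖1 / (D + e) - 1 / D‖ ≤ 2 / ‖D‖ ^ 2 := by
  have h1 : ‖D‖ / 2 ≤ ‖D + e‖ := by
    have := norm_sub_le (D + e) e
    rw [add_sub_cancel_right] at this
    linarith
  have hD0 : D ≠ 0 := norm_pos_iff.1 (by linarith)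
  have hDe : D + e ≠ 0 := norm_pos_iff.1 (by linarith)
  have h2 : 1 / (D + e) - 1 / D = -e / ((D + e) * D) := by
    field_simp
    ring
  rw [h2, norm_div, norm_mul, norm_neg]
  calc _ ≤ 1 / (‖D‖ / 2 * ‖D‖) := by gcongr
    _ = _ := by ring

lemma norm_add_mul_I_eq_sub (x y : ℤ) : ‖(x : ℂ) - y * I‖ = ‖(x : ℂ) + y * I‖ := by
  rw [← Complex.norm_conj ((x : ℂ) + y * I)]
  simp [sub_eq_add_neg]

/-- The leading term of the coupling function may be taken at a neighbouring lattice point, except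
that the sign `(-1) ^ y` has to be kept. -/
lemma exists_norm_couplingFromZero_shift_sub_le :
    ∃ K : ℝ, 0 ≤ K ∧ ∀ p q u v : ℤ, Odd (p + u + (q + v)) → 2 ≤ ‖(p : ℂ) + q * I‖ →
      ‖(u : ℂ) + v * I‖ ≤ 1 →
      ‖couplingFromZero (p + u : ℤ) (q + v : ℤ) -
          1 / (2 * Real.pi) * (1 / (p + q * I) + (-1) ^ (q + v) / (p - q * I))‖ ≤
        K / ‖(p : ℂ) + q * I‖ ^ 2 := by
  obtain ⟨K, hK, h⟩ := exists_norm_couplingFromZero_sub_le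
  refine ⟨4 * K + 4, by positivity, fun p q u v hodd hD he => ?_⟩
  have h0 := h (p + u) (q + v) hodd
  have e1 : ((p + u : ℤ) : ℂ) + (q + v : ℤ) * I = (p + q * I) + (u + v * I) := by
    push_cast; ring
  have e2 : ((p + u : ℤ) : ℂ) - (q + v : ℤ) * I = (p - q * I) + (u - v * I) := by
    push_cast; ring
  rw [e1, e2] at h0
  have hD' := hD
  have he' := he
  rw [← norm_add_mul_I_eq_sub] at hD' he'
  have h1 := norm_one_div_sub_one_div_le hD he
  have h2 := norm_one_div_sub_one_div_le hD' he'
  rw [norm_add_mul_I_eq_sub] at h2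
  set D : ℂ := p + q * I with hDdef
  set E : ℂ := p - q * I
  set e : ℂ := u + v * I
  set e' : ℂ := u - v * I
  have hDe : ‖D‖ / 2 ≤ ‖D + e‖ := by
    have := norm_sub_le (D + e) e
    rw [add_sub_cancel_right] at this
    linarith
  have hDpos : 0 < ‖D‖ := by linarith
  have h3 : K / ‖D + e‖ ^ 2 ≤ 4 * K / ‖D‖ ^ 2 := by
    calc _ ≤ K / (‖D‖ / 2) ^ 2 := by gcongr
      _ = _ := by ring
  have hpi := norm_one_div_two_pi_le_one
  have hs : ‖((-1 : ℂ)) ^ (q + v)‖ = 1 := by simp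
  set σ : ℂ := (-1) ^ (q + v)
  have split : couplingFromZero (p + u : ℤ) (q + v : ℤ) - 1 / (2 * Real.pi) * (1 / D + σ / E) =
      (couplingFromZero (p + u : ℤ) (q + v : ℤ) -
        1 / (2 * Real.pi) * (1 / (D + e) + σ / (E + e'))) +
      1 / (2 * Real.pi) * ((1 / (D + e) - 1 / D) + σ * (1 / (E + e') - 1 / E)) := by
    ring
  rw [split]
  refine (norm_add_le _ _).trans ?_
  rw [norm_mul]
  have h4 : ‖(1 / (D + e) - 1 / D) + σ * (1 / (E + e') - 1 / E)‖ ≤ 4 / ‖D‖ ^ 2 := by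
    refine (norm_add_le _ _).trans ?_
    rw [norm_mul, hs, one_mul]
    refine (add_le_add h1 h2).trans_eq ?_
    ring
  calc _ ≤ 4 * K / ‖D‖ ^ 2 + 1 * (4 / ‖D‖ ^ 2) :=
        add_le_add (h0.trans h3) (by gcongr)
    _ = _ := by ring

/-- With `α = π / 8` the sum is `(cos α - i sin α) exp (i α)`. -/
lemma spinor_coefficients :
    (Real.cos (Real.pi / 8) : ℂ) * Complex.exp (Real.pi * I / 8) +
      (Real.sin (Real.pi / 8) : ℂ) * Complex.exp (-(3 * Real.pi * I / 8)) = 1 := by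
  have h1 : Complex.exp (-(3 * Real.pi * I / 8)) =
      Complex.exp (Real.pi * I / 8) * Complex.exp (-(Real.pi / 2 * I)) := by
    rw [← Complex.exp_add]
    congr 1
    ring
  have h2 : Complex.exp (-(Real.pi / 2 * I)) = -I := by
    rw [Complex.exp_neg, Complex.exp_pi_div_two_mul_I, Complex.inv_I]
  have h3 : (Real.cos (Real.pi / 8) : ℂ) - (Real.sin (Real.pi / 8) : ℂ) * I =
      Complex.exp (-(Real.pi * I / 8)) := by
    rw [show -(Real.pi * I / 8) = ((-(Real.pi / 8) : ℝ) : ℂ) * I by push_cast; ring,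
      Complex.exp_mul_I, ← Complex.ofReal_cos, ← Complex.ofReal_sin, Real.cos_neg, Real.sin_neg]
    push_cast
    ring
  have h4 : Complex.exp (-(Real.pi * I / 8)) * Complex.exp (Real.pi * I / 8) = 1 := by
    rw [← Complex.exp_add, neg_add_cancel, Complex.exp_zero]
  rw [h1, h2]
  rw [← h3] at h4
  linear_combination h4

lemma coupling_eq {z₁ z₂ : ℂ} {x y : ℤ} (h : z₂ - z₁ = x + y * I) :
    coupling z₁ z₂ = couplingFromZero x y := by
  rw [coupling, h]
  simp

/-- In each of the two pairs of coupling functions the antiholomorphic leading terms cancel and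
the holomorphic ones add up; the two coefficients have sum `1`. -/
lemma exists_norm_discreteSpinor_sub_le :
    ∃ K : ℝ, 0 ≤ K ∧ ∀ (δ : ℝ) (a z : ℂ), 0 < δ → a ∈ horizontalEdgeMidpoints δ →
      z ∈ edgeMidpoints δ → δ ≤ ‖z - a‖ →
      ‖1 / (δ : ℂ) * discreteSpinor δ a z - continuousSpinor a z‖ ≤ K * δ / ‖z - a‖ ^ 2 := by
  obtain ⟨K, hK, h⟩ := exists_norm_couplingFromZero_shift_sub_le
  refine ⟨K, hK, fun δ a z hδ ha hz haz => ?_⟩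
  obtain ⟨m, n, hm, hn, rfl⟩ := exists_of_mem_horizontalEdgeMidpoints hδ ha
  obtain ⟨m', n', hmn, rfl⟩ := exists_of_mem_edgeMidpoints hδ hz
  have hδC : (δ : ℂ) ≠ 0 := Complex.ofReal_ne_zero.2 hδ.ne'
  obtain ⟨p, rfl⟩ : ∃ p, m' = m + p := ⟨m' - m, by ring⟩
  obtain ⟨q, rfl⟩ : ∃ q, n' = n + q := ⟨n' - n, by ring⟩
  set a : ℂ := δ / 2 * (m + n * I) with ha'
  set z : ℂ := δ / 2 * ((m + p : ℤ) + (n + q : ℤ) * I) with hz'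
  set D : ℂ := p + q * I with hD
  have hza : z - a = δ / 2 * D := by
    rw [ha', hz', hD]; push_cast; ring
  have hnza : ‖z - a‖ = δ / 2 * ‖D‖ := by
    rw [hza, norm_mul, norm_div, Complex.norm_real, Real.norm_eq_abs, abs_of_pos hδ]
    simp
  have hD2 : 2 ≤ ‖D‖ := by
    rw [hnza] at haz
    nlinarith
  have hD0 : D ≠ 0 := norm_pos_iff.1 (by linarith)
  have hne : a ≠ z := by
    intro h0
    rw [h0, sub_self, norm_zero] at haz
    linarith
  have hpq : Even (p + q) := by
    simp only [Int.odd_iff, Int.even_iff] at *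
    omega
  have hodd : ∀ u v : ℤ, Odd (u + v) → Odd (p + u + (q + v)) := by
    intro u v huv
    rw [show p + u + (q + v) = p + q + (u + v) by ring]
    exact hpq.add_odd huv
  have t1 := h p q (-1) 0 (hodd _ _ (by decide)) hD2 (by simp)
  have t2 := h p q 0 1 (hodd _ _ (by decide)) hD2 (by simp)
  have t3 := h p q 1 0 (hodd _ _ (by decide)) hD2 (by simp)
  have t4 := h p q 0 (-1) (hodd _ _ (by decide)) hD2 (by simp)
  have c1 : coupling (2 * (a + δ / 2) / δ) (2 * z / δ) =
      couplingFromZero (p + -1 : ℤ) (q + 0 : ℤ) := coupling_eq (by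
    rw [ha', hz']; push_cast; field_simp; ring)
  have c2 : coupling (2 * (a - I * δ / 2) / δ) (2 * z / δ) =
      couplingFromZero (p + 0 : ℤ) (q + 1 : ℤ) := coupling_eq (by
    rw [ha', hz']; push_cast; field_simp; ring)
  have c3 : coupling (2 * (a - δ / 2) / δ) (2 * z / δ) =
      couplingFromZero (p + 1 : ℤ) (q + 0 : ℤ) := coupling_eq (by
    rw [ha', hz']; push_cast; field_simp; ring)
  have c4 : coupling (2 * (a + I * δ / 2) / δ) (2 * z / δ) =
      couplingFromZero (p + 0 : ℤ) (q + -1 : ℤ) := coupling_eq (by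
    rw [ha', hz']; push_cast; field_simp; ring)
  rw [discreteSpinor, if_neg hne, c1, c2, c3, c4]
  have hm1 : ((-1 : ℂ)) ≠ 0 := by norm_num
  have s1 : ((-1 : ℂ)) ^ (q + 1) = -(-1) ^ q := by rw [zpow_add₀ hm1]; simp
  have s2 : ((-1 : ℂ)) ^ (q + -1) = -(-1) ^ q := by rw [zpow_add₀ hm1]; simp
  rw [s1] at t2
  rw [s2] at t4
  simp only [add_zero, ← hD] at t1 t2 t3 t4 ⊢
  have hco := spinor_coefficients
  have nco1 : ‖(Real.cos (Real.pi / 8) : ℂ) * Complex.exp (Real.pi * I / 8)‖ ≤ 1 := by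
    rw [norm_mul, Complex.norm_real, show (Real.pi : ℂ) * I / 8 = ((Real.pi / 8 : ℝ) : ℂ) * I by
      push_cast; ring, Complex.norm_exp_ofReal_mul_I, mul_one]
    exact Real.abs_cos_le_one _
  have nco2 : ‖(Real.sin (Real.pi / 8) : ℂ) * Complex.exp (-(3 * Real.pi * I / 8))‖ ≤ 1 := by
    rw [norm_mul, Complex.norm_real, show -(3 * (Real.pi : ℂ) * I / 8) =
      ((-(3 * Real.pi / 8) : ℝ) : ℂ) * I by push_cast; ring,
      Complex.norm_exp_ofReal_mul_I, mul_one]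
    exact Real.abs_sin_le_one _
  set A := (Real.cos (Real.pi / 8) : ℂ) * Complex.exp (Real.pi * I / 8)
  set B := (Real.sin (Real.pi / 8) : ℂ) * Complex.exp (-(3 * Real.pi * I / 8))
  set σ : ℂ := (-1) ^ q
  set E : ℂ := p - q * I
  set C1 := couplingFromZero (p + -1 : ℤ) (q : ℤ)
  set C2 := couplingFromZero (p : ℤ) (q + 1 : ℤ)
  set C3 := couplingFromZero (p + 1 : ℤ) (q : ℤ)
  set C4 := couplingFromZero (p : ℤ) (q + -1 : ℤ)
  have hpiC : (Real.pi : ℂ) ≠ 0 := Complex.ofReal_ne_zero.2 Real.pi_pos.ne'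
  have hcont : continuousSpinor a z = 1 / δ * ((A + B) * (1 / (Real.pi * D))) := by
    rw [continuousSpinor, hza, hco]
    field_simp
  rw [hcont, ← mul_sub, norm_mul, norm_div, norm_one, Complex.norm_real, Real.norm_eq_abs,
    abs_of_pos hδ]
  have split : A * (C1 + C2) + B * (C3 + C4) - (A + B) * (1 / (Real.pi * D)) =
      A * ((C1 - 1 / (2 * Real.pi) * (1 / D + σ / E)) +
        (C2 - 1 / (2 * Real.pi) * (1 / D + -σ / E))) +
      B * ((C3 - 1 / (2 * Real.pi) * (1 / D + σ / E)) +
        (C4 - 1 / (2 * Real.pi) * (1 / D + -σ / E))) := by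
    have : 1 / (Real.pi * D) = 2 * (1 / (2 * Real.pi) * (1 / D)) := by field_simp
    rw [this, neg_div]
    ring
  have hsum : ‖A * (C1 + C2) + B * (C3 + C4) - (A + B) * (1 / (Real.pi * D))‖ ≤
      4 * (K / ‖D‖ ^ 2) := by
    rw [split]
    refine (norm_add_le _ _).trans ?_
    rw [norm_mul A, norm_mul B]
    calc _ ≤ 1 * (K / ‖D‖ ^ 2 + K / ‖D‖ ^ 2) + 1 * (K / ‖D‖ ^ 2 + K / ‖D‖ ^ 2) := by
          have r1 := (norm_add_le _ _).trans (add_le_add t1 t2)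
          have r2 := (norm_add_le _ _).trans (add_le_add t3 t4)
          exact add_le_add (mul_le_mul nco1 r1 (norm_nonneg _) zero_le_one)
            (mul_le_mul nco2 r2 (norm_nonneg _) zero_le_one)
      _ = _ := by ring
  have hDpos : 0 < ‖D‖ := by linarith
  calc _ ≤ 1 / δ * (4 * (K / ‖D‖ ^ 2)) := by gcongr
    _ = K * δ / ‖z - a‖ ^ 2 := by
      rw [hnza]
      field_simp
      ring

lemma norm_continuousSpinor_sub_le {a z a' z' : ℂ} (h : a ≠ z) (h' : a' ≠ z') :
    ‖continuousSpinor a' z' - continuousSpinor a z‖ ≤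
      (dist a a' + dist z z') / (‖z' - a'‖ * ‖z - a‖) := by
  have hpiC : (Real.pi : ℂ) ≠ 0 := Complex.ofReal_ne_zero.2 Real.pi_pos.ne'
  have h1 : z - a ≠ 0 := sub_ne_zero.2 h.symm
  have h2 : z' - a' ≠ 0 := sub_ne_zero.2 h'.symm
  have e : continuousSpinor a' z' - continuousSpinor a z =
      1 / (2 * Real.pi) * (((z - z') - (a - a')) / ((z' - a') * (z - a))) := by
    rw [continuousSpinor, continuousSpinor]
    field_simp
    ring
  have hpi := norm_one_div_two_pi_le_one
  rw [e, norm_mul]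
  refine (mul_le_of_le_one_left (norm_nonneg _) hpi).trans ?_
  rw [norm_div, norm_mul, dist_eq_norm, dist_eq_norm]
  gcongr
  exact (norm_sub_le _ _).trans_eq (add_comm _ _)

end FullPlaneSpinor

theorem mainTheorem6
    (roundA roundZ : ℝ → ℂ → ℂ)
    (hA : ∀ δ : ℝ, 0 < δ → ∀ w : ℂ,
      FullPlaneSpinor.IsClosestPoint (FullPlaneSpinor.horizontalEdgeMidpoints δ) w (roundA δ w))
    (hZ : ∀ δ : ℝ, 0 < δ → ∀ w : ℂ,
      FullPlaneSpinor.IsClosestPoint (FullPlaneSpinor.edgeMidpoints δ) w (roundZ δ w))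
    (ε : ℝ) (hε : 0 < ε) :
    TendstoUniformlyOn
      (fun (δ : ℝ) (p : ℂ × ℂ) =>
        (1 / (δ : ℂ)) * FullPlaneSpinor.discreteSpinor δ (roundA δ p.1) (roundZ δ p.2))
      (fun p : ℂ × ℂ => FullPlaneSpinor.continuousSpinor p.1 p.2)
      (𝓝[>] (0 : ℝ))
      {p : ℂ × ℂ | ε ≤ ‖p.1 - p.2‖} := by
  obtain ⟨K, hK, h⟩ := FullPlaneSpinor.exists_norm_discreteSpinor_sub_le
  rw [Metric.tendstoUniformlyOn_iff]
  intro η hη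
  have hlim : Tendsto (fun δ : ℝ => (4 * K + 8) / ε ^ 2 * δ) (𝓝[>] 0) (𝓝 0) := by
    have : Tendsto (fun δ : ℝ => (4 * K + 8) / ε ^ 2 * δ) (𝓝 0) (𝓝 ((4 * K + 8) / ε ^ 2 * 0)) :=
      tendsto_id.const_mul _
    rw [mul_zero] at this
    exact this.mono_left nhdsWithin_le_nhds
  have hsmall : ∀ᶠ δ : ℝ in 𝓝[>] 0, δ < ε / 8 :=
    nhdsWithin_le_nhds (Iio_mem_nhds (by positivity))
  filter_upwards [hlim.eventually_lt_const hη, hsmall, self_mem_nhdsWithin] with δ h1 h2 hδ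
  rintro ⟨a, z⟩ haz
  change ε ≤ ‖a - z‖ at haz
  rw [Set.mem_Ioi] at hδ
  have dA := (hA δ hδ a).dist_le hδ subset_rfl
  have dZ := (hZ δ hδ z).dist_le hδ (FullPlaneSpinor.horizontalEdgeMidpoints_subset δ)
  have mA := (hA δ hδ a).1
  have mZ := (hZ δ hδ z).1
  set a' := roundA δ a
  set z' := roundZ δ z
  rw [← dist_eq_norm] at haz
  have hfar : ε / 2 ≤ dist a' z' := by
    have := dist_triangle4 a a' z' z
    rw [dist_comm z' z] at this
    linarith
  have hne : a ≠ z := dist_pos.1 (hε.trans_le haz)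
  have hne' : a' ≠ z' := dist_pos.1 ((half_pos hε).trans_le hfar)
  rw [dist_comm, dist_eq_norm] at haz hfar
  have b1 := h δ a' z' hδ mA mZ (by linarith)
  have b2 := FullPlaneSpinor.norm_continuousSpinor_sub_le hne hne'
  have b1' : K * δ / ‖z' - a'‖ ^ 2 ≤ K * δ / (ε / 2) ^ 2 := by gcongr
  have b2' : (dist a a' + dist z z') / (‖z' - a'‖ * ‖z - a‖) ≤
      (2 * δ + 2 * δ) / (ε / 2 * ε) := by gcongr
  rw [dist_comm, dist_eq_norm]
  calc _ ≤ K * δ / (ε / 2) ^ 2 + (2 * δ + 2 * δ) / (ε / 2 * ε) :=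
        (norm_sub_le_norm_sub_add_norm_sub _ _ _).trans
          (add_le_add (b1.trans b1') (b2.trans b2'))
    _ = (4 * K + 8) / ε ^ 2 * δ := by field_simp; ring
    _ < η := h1
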